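/- Let $G$ be a finite, simple, connected graph. The matching cover number $mc(G)$ is the least $k\ge 0$ such that there are $k$ matchings of $G$ which together cover all vertices of $G$ (a matching covers a vertex if one of its edges contains it). Let $D(G)$ be the set of vertices of $G$ left uncovered by some maximum matching of $G$, let $A(G)$ be the set of vertices of $V(G)\setminus D(G)$ that are adjacent to at least one vertex of $D(G)$, and let $D^*$ be the set of isolated vertices of the induced subgraph $G[D(G)]$. Let $G^*$ be the bipartite graph with vertex set $A(G)\cup D^*$ whose edges are the edges of $G$ joining a vertex of $A(G)$ to a vertex of $D^*$, and let $md(G^*)$ be the least $k\ge 0$ such that there are $k$ matchings of $G^*$ which together cover $D^*$ (so $md(G^*)=0$ if $D^*=\emptyset$). Suppose that $A(G)\neq\emptyset$. Then such a $k$ exists, i.e. $md(G^*)$ is finite. If $md(G^*)\le 1$, then $mc(G)=2$; if $md(G^*)\ge 2$, then $mc(G)=md(G^*)$. -/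

import Mathlib

namespace MatchingCover

variable {V : Type*}

/-- `M` is a maximum matching of `G`: a matching with the largest possible number of edges. -/
def IsMaximumMatching (G : SimpleGraph V) (M : G.Subgraph) : Prop :=
  M.IsMatching ∧
    ∀ M' : G.Subgraph, M'.IsMatching → M'.edgeSet.ncard ≤ M.edgeSet.ncard

/-- `D(G)`: the vertices that are left uncovered by some maximum matching of `G`. -/
def setD (G : SimpleGraph V) : Set V :=
  {x | ∃ M : G.Subgraph, IsMaximumMatching G M ∧ x ∉ M.verts}

/-- `A(G) = N_G(D(G))`: the vertices outside `D(G)` with a neighbour in `D(G)`. -/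
def setA (G : SimpleGraph V) : Set V :=
  {v | v ∉ setD G ∧ ∃ u ∈ setD G, G.Adj u v}

/-- `D*`: the isolated vertices of the induced subgraph `G[D(G)]`. -/
def setDStar (G : SimpleGraph V) : Set V :=
  {x | x ∈ setD G ∧ ∀ y ∈ setD G, ¬ G.Adj x y}

/-- `G*`: the bipartite subgraph of `G` on the vertex set `A(G) ∪ D*`, whose edges are
the edges of `G` between `A(G)` and `D*`. -/
def graphStar (G : SimpleGraph V) : G.Subgraph where
  verts := setA G ∪ setDStar G
  Adj u v := G.Adj u v ∧ ((u ∈ setA G ∧ v ∈ setDStar G) ∨ (u ∈ setDStar G ∧ v ∈ setA G))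
  adj_sub h := h.1
  edge_vert h := h.2.elim (fun h => Or.inl h.1) (fun h => Or.inr h.1)
  symm := ⟨fun _ _ h => ⟨h.1.symm, h.2.elim (fun h => Or.inr h.symm) (fun h => Or.inl h.symm)⟩⟩

/-- The subgraph `H` of `G` has `k` matchings that together cover every vertex of `S`. -/
def HasMatchingCover {G : SimpleGraph V} (H : G.Subgraph) (S : Set V) (k : ℕ) : Prop :=
  ∃ M : Fin k → G.Subgraph,
    (∀ i, (M i).IsMatching ∧ M i ≤ H) ∧ S ⊆ ⋃ i, (M i).verts

/-- `mc(G)`: the least `k` such that `k` matchings of `G` together cover `V(G)`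
(`⊤` if there is no such `k`). -/
noncomputable def mc (G : SimpleGraph V) : ℕ∞ :=
  ⨅ (k : ℕ) (_ : HasMatchingCover (⊤ : G.Subgraph) Set.univ k), (k : ℕ∞)

/-- `md(G*)`: the least `k` such that `k` matchings of `G*` together cover `D*`
(`⊤` if there is no such `k`). -/
noncomputable def mdStar (G : SimpleGraph V) : ℕ∞ :=
  ⨅ (k : ℕ) (_ : HasMatchingCover (graphStar G) (setDStar G) k), (k : ℕ∞)

end MatchingCover

/-!
The lower bound `md(G*) ≤ mc(G)` holds because a vertex of `D*` has all its neighbours in `A(G)`,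
so that any cover of `G` by matchings restricts to a cover of `D*` by matchings of `G*`
(`HasMatchingCover.restrict_graphStar`). Moreover `mc(G) ≥ 2`, since a perfect matching would force
`D(G) = ∅` and hence `A(G) = ∅`.

The upper bound `mc(G) ≤ max 2 md(G*)` does not go through the Gallai–Edmonds structure theorem. It
rests on an exchange property of the vertex sets of matchings (`exists_exchange`), essentially the
matching matroid, which has two consequences.
* Every set covered by a matching is covered by a maximum matching
  (`exists_isMaximumMatching_superset`). Thus the matchings of `G*` covering `D*` may be replaced by
  maximum matchings `N₀, N₁, …` of `G` that still cover `D*`. By the definition of `D(G)`, each of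
  them covers every vertex outside `D(G)`.
* If `y ∈ D(G)` is adjacent to distinct `x` and `z`, no maximum matching misses both `x` and `z`
  (`IsMaximumMatching.mem_or_mem_of_adj_setD`, a form of Gallai's lemma).

It remains to cover `D(G) \ D*`. If `x` in this set is missed by both `N₀` and `N₁`, take a
neighbour `y ∈ D(G)` of `x`, let `z` be its partner in `N₀`, and replace the edge `yz` by `xy`.
Then `z` is the only vertex that `N₀` loses; it is not in `D*`, being adjacent to `y`, and it is
covered by `N₁`, which already misses `x`. So fewer vertices outside `D*` are missed by both
matchings, and repeating the step ends with none (`exists_pair_cover`).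
-/

namespace MatchingCover

open SimpleGraph

variable {V : Type*} {G : SimpleGraph V}

/-! ### Restricting covers to `G*` -/

theorem mem_setA_of_adj {x y : V} (hx : x ∈ setDStar G) (h : G.Adj x y) : y ∈ setA G :=
  ⟨fun hy => hx.2 y hy h, x, hx.1, h⟩

/-- An edge at a vertex of `D*` belongs to `G*`, so a matching loses no vertex of `D*` when its
edges outside `G*` are dropped. -/
theorem HasMatchingCover.restrict_graphStar {k : ℕ}
    (h : HasMatchingCover (⊤ : G.Subgraph) Set.univ k) :
    HasMatchingCover (graphStar G) (setDStar G) k := by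
  obtain ⟨M, hM, hcov⟩ := h
  refine ⟨fun i =>
    { verts := {v | ∃ w, (M i).Adj v w ∧ (graphStar G).Adj v w}
      Adj := fun v w => (M i).Adj v w ∧ (graphStar G).Adj v w
      adj_sub := fun h => h.1.adj_sub
      edge_vert := fun {v w} h => ⟨w, h⟩
      symm := ⟨fun _ _ h => ⟨h.1.symm, h.2.symm⟩⟩ }, fun i => ⟨?_, ?_, ?_⟩, fun x hx => ?_⟩
  · rintro v ⟨w, hw⟩
    exact ⟨w, hw, fun b hb => (hM i).1.eq_of_adj_left hb.1 hw.1⟩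
  · rintro v ⟨w, hw⟩
    exact (graphStar G).edge_vert hw.2
  · exact fun v w h => h.2
  · obtain ⟨i, hi⟩ := Set.mem_iUnion.1 (hcov (Set.mem_univ x))
    obtain ⟨y, hy, -⟩ := (hM i).1 hi
    exact Set.mem_iUnion.2 ⟨i, y, hy, hy.adj_sub, .inr ⟨hx, mem_setA_of_adj hx hy.adj_sub⟩⟩

/-! ### The numbers `mc` and `md` as least sizes of covers -/

theorem HasMatchingCover.mono {H : G.Subgraph} {S : Set V} {k l : ℕ} (hkl : k ≤ l)
    (h : HasMatchingCover H S k) : HasMatchingCover H S l := by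
  obtain ⟨M, hM, hcov⟩ := h
  refine ⟨fun i => if hi : i.1 < k then M ⟨i, hi⟩ else ⊥, fun i => ?_, fun x hx => ?_⟩
  · dsimp only
    split_ifs with hi
    · exact hM _
    · exact ⟨fun v hv => by simp at hv, bot_le⟩
  · obtain ⟨i, hi⟩ := Set.mem_iUnion.1 (hcov hx)
    exact Set.mem_iUnion.2 ⟨⟨i, i.2.trans_le hkl⟩, by simpa using hi⟩

theorem iInf_le_natCast_iff {P : ℕ → Prop} (hP : ∀ k l, k ≤ l → P k → P l) {n : ℕ} :
    ⨅ (k : ℕ) (_ : P k), (k : ℕ∞) ≤ n ↔ P n := by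
  refine ⟨fun h => by_contra fun hn => ?_, fun h => iInf₂_le n h⟩
  have : ((n + 1 : ℕ) : ℕ∞) ≤ ⨅ (k : ℕ) (_ : P k), (k : ℕ∞) :=
    le_iInf₂ fun k hk => Nat.cast_le.2 (not_le.1 fun hkn => hn (hP k n hkn hk))
  exact absurd (Nat.cast_le.1 (this.trans h)) (by omega)

theorem mc_le_iff {n : ℕ} : mc G ≤ n ↔ HasMatchingCover (⊤ : G.Subgraph) Set.univ n :=
  iInf_le_natCast_iff fun _ _ h => HasMatchingCover.mono h

theorem mdStar_le_iff {n : ℕ} : mdStar G ≤ n ↔ HasMatchingCover (graphStar G) (setDStar G) n :=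
  iInf_le_natCast_iff fun _ _ h => HasMatchingCover.mono h

variable (G) in
theorem mdStar_le_mc : mdStar G ≤ mc G :=
  le_iInf₂ fun _ hk => mdStar_le_iff.2 hk.restrict_graphStar

/-! ### Elementary operations on matchings -/

theorem exists_isMatching_insert {M : G.Subgraph} (hM : M.IsMatching) {u v : V}
    (huv : G.Adj u v) (hu : u ∉ M.verts) (hv : v ∉ M.verts) :
    ∃ M' : G.Subgraph, M'.IsMatching ∧ M'.verts = M.verts ∪ {u, v} := by
  refine ⟨M ⊔ G.subgraphOfAdj huv, hM.sup (.subgraphOfAdj huv) ?_, by simp⟩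
  rw [hM.support_eq_verts, (Subgraph.IsMatching.subgraphOfAdj huv).support_eq_verts]
  simp [hu, hv]

/-- Replacing the edge `ut` of a matching by an edge `uv` with `v` uncovered. -/
theorem exists_isMatching_switch {M : G.Subgraph} (hM : M.IsMatching) {u t v : V}
    (hut : M.Adj u t) (huv : G.Adj u v) (hv : v ∉ M.verts) :
    ∃ M' : G.Subgraph, M'.IsMatching ∧ M'.verts = insert v (M.verts \ {t}) ∧
      M'.Adj u v ∧ ∀ a b, M.Adj a b → s(a, b) ≠ s(u, t) → M'.Adj a b := by
  have hu := M.edge_vert hut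
  have hne := (M.adj_sub hut).ne
  have hvt : v ≠ t := fun h => hv (h ▸ M.edge_vert hut.symm)
  -- An edge of `M` other than `ut` meets neither `u` nor `t`.
  have key : ∀ a b, M.Adj a b → s(a, b) ≠ s(u, t) → a ∉ ({u, t} : Set V) := by
    rintro a b hab hs (rfl | rfl)
    · exact hs (by rw [hM.eq_of_adj_left hab hut])
    · exact hs (by rw [hM.eq_of_adj_left hab hut.symm, Sym2.eq_swap])
  have hD : (M.deleteVerts {u, t}).IsMatching := by
    rintro a ⟨ha, hat⟩
    obtain ⟨b, hab, hb⟩ := hM ha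
    refine ⟨b, ?_, fun c hc => hb c (Subgraph.deleteVerts_adj.1 hc).2.2.2.2⟩
    refine Subgraph.deleteVerts_adj.2 ⟨ha, hat, M.edge_vert hab.symm, ?_, hab⟩
    refine key b a hab.symm fun h => hat ?_
    have : a ∈ s(u, t) := h ▸ Sym2.mem_mk_right b a
    simpa using this
  refine ⟨M.deleteVerts {u, t} ⊔ G.subgraphOfAdj huv, hD.sup (.subgraphOfAdj huv) ?_, ?_, ?_, ?_⟩
  · rw [hD.support_eq_verts, (Subgraph.IsMatching.subgraphOfAdj huv).support_eq_verts]
    simp [hv]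
  · ext a
    simp only [Subgraph.verts_sup, Subgraph.deleteVerts_verts, subgraphOfAdj_verts, Set.mem_union,
      Set.mem_sdiff, Set.mem_insert_iff, Set.mem_singleton_iff]
    grind
  · simp
  · intro a b hab hs
    refine Subgraph.sup_adj.2 (.inl (Subgraph.deleteVerts_adj.2
      ⟨M.edge_vert hab, key a b hab hs, M.edge_vert hab.symm, key b a hab.symm ?_, hab⟩))
    rwa [Sym2.eq_swap]

variable [Finite V]

theorem ncard_verts_eq_two_mul {M : G.Subgraph} (hM : M.IsMatching) :
    M.verts.ncard = 2 * M.edgeSet.ncard := by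
  classical
  cases nonempty_fintype V
  have h := M.spanningCoe.sum_degrees_eq_twice_card_edges
  have hd : ∀ v, M.spanningCoe.degree v = if v ∈ M.verts then 1 else 0 := by
    intro v
    split_ifs with hv
    · obtain ⟨w, hw, hu⟩ := hM hv
      rw [← card_neighborFinset_eq_degree, Finset.card_eq_one]
      exact ⟨w, by ext b; simpa using ⟨hu b, fun h => h ▸ hw⟩⟩
    · rw [← card_neighborFinset_eq_degree, Finset.card_eq_zero, Finset.eq_empty_iff_forall_notMem]
      intro b hb
      exact hv (M.edge_vert (by simpa using hb))
  rw [Finset.sum_congr rfl fun v _ => hd v, Finset.sum_boole] at h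
  rw [Set.ncard_eq_toFinset_card', Set.ncard_eq_toFinset_card']
  convert h using 2
  · simp [Set.toFinset]
  · congr 1
    ext e
    simp

theorem IsMaximumMatching.ncard_verts_le {M M' : G.Subgraph} (hM : IsMaximumMatching G M)
    (hM' : M'.IsMatching) : M'.verts.ncard ≤ M.verts.ncard := by
  rw [ncard_verts_eq_two_mul hM.1, ncard_verts_eq_two_mul hM']
  exact Nat.mul_le_mul_left 2 (hM.2 M' hM')

theorem IsMaximumMatching.of_ncard_verts_le {M M' : G.Subgraph} (hM : IsMaximumMatching G M)
    (hM' : M'.IsMatching) (h : M.verts.ncard ≤ M'.verts.ncard) : IsMaximumMatching G M' := by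
  rw [ncard_verts_eq_two_mul hM.1, ncard_verts_eq_two_mul hM'] at h
  exact ⟨hM', fun N hN => (hM.2 N hN).trans (by omega)⟩

/-! ### Exchange between matchings -/

/-- The exchange property: the effect of switching `M` along the path of `M ∆ N` that starts at `v`
and ends at `w`. The two cases say whether the last edge of the path belongs to `N` or to `M`. The
path is followed by induction on the number of edges of `N` not in `M`. -/
theorem exists_exchange {M N : G.Subgraph} (hM : M.IsMatching) (hN : N.IsMatching) {v : V}
    (hvN : v ∈ N.verts) (hvM : v ∉ M.verts) :
    ∃ M' : G.Subgraph, M'.IsMatching ∧ ∃ w,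
      (w ∉ M.verts ∧ w ≠ v ∧ M'.verts = M.verts ∪ {w, v}) ∨
      (w ∈ M.verts ∧ w ∉ N.verts ∧ M'.verts = insert v (M.verts \ {w})) := by
  induction hn : (N.edgeSet \ M.edgeSet).ncard using Nat.strong_induction_on generalizing M v with
  | _ n ih =>
  subst hn
  obtain ⟨u, hvu, -⟩ := hN hvN
  have huv : G.Adj u v := (N.adj_sub hvu).symm
  by_cases hu : u ∈ M.verts
  · obtain ⟨t, hut, -⟩ := hM hu
    have htM := M.edge_vert hut.symm
    have htv : t ≠ v := fun h => hvM (h ▸ htM)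
    obtain ⟨M₁, hM₁, hverts, huv₁, hsub⟩ := exists_isMatching_switch hM hut huv hvM
    by_cases ht : t ∈ N.verts
    · -- The vertex `t` is no longer covered; the path continues from it.
      have htM₁ : t ∉ M₁.verts := by simp [hverts, htv]
      have hlt : (N.edgeSet \ M₁.edgeSet).ncard < (N.edgeSet \ M.edgeSet).ncard := by
        refine Set.ncard_lt_ncard (Set.ssubset_iff_of_subset ?_ |>.2 ⟨s(u, v), ?_, ?_⟩)
          (Set.toFinite _)
        · intro e
          induction e with | _ a b
          rintro ⟨haN, haM⟩
          refine ⟨haN, fun hab => haM (hsub a b hab fun he => ?_)⟩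
          -- The edge `ut` is not in `N`, as `N` matches `u` with `v ≠ t`.
          have : N.Adj u t := by
            rw [← Subgraph.mem_edgeSet, ← he]; exact haN
          exact htv (hN.eq_of_adj_left this hvu.symm)
        · exact ⟨hvu.symm, fun h => hvM (M.edge_vert (Subgraph.mem_edgeSet.1 h).symm)⟩
        · exact fun h => h.2 huv₁
      obtain ⟨M', hM', w, h⟩ := ih _ hlt hM₁ ht htM₁ rfl
      refine ⟨M', hM', w, ?_⟩
      simp only [hverts, Set.ext_iff, Set.mem_union, Set.mem_insert_iff, Set.mem_sdiff,
        Set.mem_singleton_iff] at h ⊢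
      grind
    · exact ⟨M₁, hM₁, t, .inr ⟨htM, ht, hverts⟩⟩
  · obtain ⟨M', hM', hv⟩ := exists_isMatching_insert hM huv hu hvM
    exact ⟨M', hM', u, .inl ⟨hu, huv.ne, hv⟩⟩

theorem ncard_insert_sdiff_singleton {s : Set V} {v w : V} (hv : v ∉ s) (hw : w ∈ s) :
    (insert v (s \ {w})).ncard = s.ncard := by
  rw [Set.ncard_insert_of_notMem (fun h => hv h.1) (Set.toFinite _),
    Set.ncard_sdiff_singleton_add_one hw (Set.toFinite _)]

theorem IsMaximumMatching.exists_exchange {M N : G.Subgraph} (hM : IsMaximumMatching G M)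
    (hN : N.IsMatching) {v : V} (hvN : v ∈ N.verts) (hvM : v ∉ M.verts) :
    ∃ M' : G.Subgraph, IsMaximumMatching G M' ∧ ∃ w ∈ M.verts, w ∉ N.verts ∧
      M'.verts = insert v (M.verts \ {w}) := by
  obtain ⟨M', hM', w, ⟨-, -, h⟩ | ⟨hw, hwN, h⟩⟩ :=
    MatchingCover.exists_exchange hM.1 hN hvN hvM
  · refine absurd (hM.ncard_verts_le hM') (not_le.2 (Set.ncard_lt_ncard ?_ (Set.toFinite _)))
    rw [h]
    exact Set.ssubset_iff_of_subset Set.subset_union_left |>.2 ⟨v, by simp, hvM⟩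
  · exact ⟨M', hM.of_ncard_verts_le hM' (by rw [h, ncard_insert_sdiff_singleton hvM hw]),
      w, hw, hwN, h⟩

variable (G) in
theorem exists_isMaximumMatching : ∃ M : G.Subgraph, IsMaximumMatching G M := by
  have hb : (⊥ : G.Subgraph).IsMatching := fun v hv => by simp at hv
  obtain ⟨M, hM, h⟩ := Set.exists_max_image {M : G.Subgraph | M.IsMatching}
    (fun M => M.edgeSet.ncard) (Set.toFinite _) ⟨⊥, hb⟩
  exact ⟨M, hM, h⟩

/-- A maximum matching covering as much as possible of `N.verts` covers all of it. -/
theorem exists_isMaximumMatching_superset {N : G.Subgraph} (hN : N.IsMatching) :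
    ∃ M : G.Subgraph, IsMaximumMatching G M ∧ N.verts ⊆ M.verts := by
  obtain ⟨M, hM, h⟩ := Set.exists_max_image {M : G.Subgraph | IsMaximumMatching G M}
    (fun M => (N.verts ∩ M.verts).ncard) (Set.toFinite _) (exists_isMaximumMatching G)
  refine ⟨M, hM, fun v hvN => by_contra fun hvM => ?_⟩
  obtain ⟨M', hM', w, hw, hwN, hv⟩ := IsMaximumMatching.exists_exchange hM hN hvN hvM
  refine absurd (h M' hM') (not_le.2 (Set.ncard_lt_ncard ?_ (Set.toFinite _)))
  refine Set.ssubset_iff_of_subset ?_ |>.2 ⟨v, ⟨hvN, by simp [hv]⟩, fun h => hvM h.2⟩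
  rintro a ⟨haN, haM⟩
  exact ⟨haN, by rw [hv]; exact .inr ⟨haM, fun h => hwN (h ▸ haN)⟩⟩

theorem IsMaximumMatching.mem_or_mem_of_adj {M : G.Subgraph} (hM : IsMaximumMatching G M) {x y : V}
    (hxy : G.Adj x y) : x ∈ M.verts ∨ y ∈ M.verts := by
  by_contra! h
  obtain ⟨M', hM', hv⟩ := exists_isMatching_insert hM.1 hxy h.1 h.2
  refine absurd (hM.ncard_verts_le hM') (not_le.2 (Set.ncard_lt_ncard ?_ (Set.toFinite _)))
  rw [hv]
  exact Set.ssubset_iff_of_subset Set.subset_union_left |>.2 ⟨x, by simp, h.1⟩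

/-- A form of Gallai's lemma. If `M` missed both `x` and `z`, a maximum matching missing `y` and
covering as much as possible of `M.verts` would cover all of `M.verts` but `y`, hence at most one
vertex outside `M.verts`; it would then miss an edge at `y`. -/
theorem IsMaximumMatching.mem_or_mem_of_adj_setD {M : G.Subgraph} (hM : IsMaximumMatching G M)
    {x y z : V} (hxy : G.Adj x y) (hzy : G.Adj z y) (hxz : x ≠ z) (hy : y ∈ setD G) :
    x ∈ M.verts ∨ z ∈ M.verts := by
  by_contra! hn
  obtain ⟨N, ⟨hN, hyN⟩, h⟩ := Set.exists_max_image
    {N : G.Subgraph | IsMaximumMatching G N ∧ y ∉ N.verts}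
    (fun N => (M.verts ∩ N.verts).ncard) (Set.toFinite _) hy
  have hsub : M.verts \ {y} ⊆ N.verts := by
    rintro v ⟨hvM, hvy⟩
    by_contra hvN
    obtain ⟨N', hN', w, hw, hwM, hv⟩ := IsMaximumMatching.exists_exchange hN hM.1 hvM hvN
    have hyN' : y ∉ N'.verts := by
      rw [hv]
      rintro (h | h)
      exacts [hvy h.symm, hyN h.1]
    refine absurd (h N' ⟨hN', hyN'⟩) (not_le.2 (Set.ncard_lt_ncard ?_ (Set.toFinite _)))
    refine Set.ssubset_iff_of_subset ?_ |>.2 ⟨v, ⟨hvM, by simp [hv]⟩, fun h => hvN h.2⟩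
    rintro a ⟨haM, haN⟩
    exact ⟨haM, by rw [hv]; exact .inr ⟨haN, fun h => hwM (h ▸ haM)⟩⟩
  have hx := (hN.mem_or_mem_of_adj hxy).resolve_right hyN
  have hz := (hN.mem_or_mem_of_adj hzy).resolve_right hyN
  have hcard := Set.ncard_le_ncard (s := insert x (insert z (M.verts \ {y}))) (t := N.verts)
    (Set.insert_subset hx (Set.insert_subset hz hsub)) (Set.toFinite _)
  rw [Set.ncard_insert_of_notMem (by simp [hn.1, hxz]) (Set.toFinite _),
    Set.ncard_insert_of_notMem (by simp [hn.2]) (Set.toFinite _)] at hcard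
  have h1 := Set.ncard_le_ncard_sdiff_add_ncard M.verts {y} (Set.toFinite _)
  rw [Set.ncard_singleton] at h1
  have h2 := hM.ncard_verts_le hN.1
  omega

/-! ### From covers of `D*` to covers of `G` -/

/-- The maximum matching `M` can be changed into a maximum matching `M'` that still covers the
vertices of `D*` covered by `M`, and such that `M'` and `N` together cover all other vertices. Among
the candidates for `M'`, one minimizing the number of vertices outside `D*` missed by both works. -/
theorem exists_pair_cover {M N : G.Subgraph} (hM : IsMaximumMatching G M)
    (hN : IsMaximumMatching G N) :
    ∃ M' : G.Subgraph, IsMaximumMatching G M' ∧ M.verts ∩ setDStar G ⊆ M'.verts ∧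
      (setDStar G)ᶜ ⊆ M'.verts ∪ N.verts := by
  obtain ⟨M', ⟨hM', hsub⟩, h⟩ := Set.exists_min_image
    {M' : G.Subgraph | IsMaximumMatching G M' ∧ M.verts ∩ setDStar G ⊆ M'.verts}
    (fun M' => ((setDStar G)ᶜ \ (M'.verts ∪ N.verts)).ncard) (Set.toFinite _)
    ⟨M, hM, Set.inter_subset_left⟩
  refine ⟨M', hM', hsub, fun x hx => by_contra fun hxn => ?_⟩
  obtain ⟨hxM, hxN⟩ := not_or.1 hxn
  obtain ⟨y, hy, hxy⟩ : ∃ y ∈ setD G, G.Adj x y := by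
    by_contra! hc
    exact hx ⟨⟨M', hM', hxM⟩, hc⟩
  obtain ⟨z, hyz, -⟩ := hM'.1 ((hM'.mem_or_mem_of_adj hxy).resolve_left hxM)
  have hzM := M'.edge_vert hyz.symm
  have hzy := (M'.adj_sub hyz).symm
  have hzD : z ∉ setDStar G := fun hz => hz.2 y hy hzy
  have hzN : z ∈ N.verts :=
    (hN.mem_or_mem_of_adj_setD hxy hzy (fun e => hxM (e ▸ hzM)) hy).resolve_left hxN
  obtain ⟨M₁, hM₁, hv, -⟩ := exists_isMatching_switch hM'.1 hyz hxy.symm hxM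
  have hmax : IsMaximumMatching G M₁ :=
    hM'.of_ncard_verts_le hM₁ (by rw [hv, ncard_insert_sdiff_singleton hxM hzM])
  have hsub₁ : M.verts ∩ setDStar G ⊆ M₁.verts := fun a ha => by
    rw [hv]
    exact .inr ⟨hsub ha, fun e => hzD (e ▸ ha.2)⟩
  refine absurd (h M₁ ⟨hmax, hsub₁⟩) (not_le.2 (Set.ncard_lt_ncard ?_ (Set.toFinite _)))
  refine Set.ssubset_iff_of_subset ?_ |>.2 ⟨x, ⟨hx, hxn⟩, fun h => h.2 (.inl (by simp [hv]))⟩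
  rintro a ⟨haD, ha⟩
  refine ⟨haD, ?_⟩
  rintro (haM | haN)
  · refine ha (.inl ?_)
    rw [hv]
    exact .inr ⟨haM, fun e => ha (.inr (e ▸ hzN))⟩
  · exact ha (.inr haN)

/-- Two of the `k` maximum matchings suffice for the vertices outside `D*`, whence `2 ≤ k`. -/
theorem HasMatchingCover.of_graphStar {k : ℕ} (hk : 2 ≤ k)
    (h : HasMatchingCover (graphStar G) (setDStar G) k) :
    HasMatchingCover (⊤ : G.Subgraph) Set.univ k := by
  obtain ⟨M, hM, hcov⟩ := h
  choose N hN hMN using fun i => exists_isMaximumMatching_superset (hM i).1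
  have h01 : (⟨1, hk⟩ : Fin k) ≠ ⟨0, by omega⟩ := by simp
  generalize (⟨1, hk⟩ : Fin k) = j at h01
  generalize (⟨0, by omega⟩ : Fin k) = i at h01
  obtain ⟨N', hN', hsub, hpair⟩ := exists_pair_cover (hN i) (hN j)
  refine ⟨Function.update N i N', fun l => ⟨?_, le_top⟩, fun x _ => ?_⟩
  · by_cases hl : l = i
    · subst hl; simpa using hN'.1
    · simpa [hl] using (hN l).1
  · rw [Set.mem_iUnion]
    by_cases hx : x ∈ setDStar G
    · obtain ⟨l, hl⟩ := Set.mem_iUnion.1 (hcov hx)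
      refine ⟨l, ?_⟩
      by_cases hli : l = i
      · subst hli; simpa using hsub ⟨hMN _ hl, hx⟩
      · simpa [hli] using hMN _ hl
    · rcases hpair hx with h | h
      · exact ⟨i, by simpa using h⟩
      · exact ⟨j, by simpa [h01] using h⟩

/-! ### Bounds for `mc` and `md` -/

theorem mc_le_of_mdStar_le {n : ℕ} (h : mdStar G ≤ n) (hn : 2 ≤ n) : mc G ≤ n :=
  mc_le_iff.2 ((mdStar_le_iff.1 h).of_graphStar hn)

/-- If one matching covered all vertices, so would every maximum matching, and `D(G)` would be
empty. -/
theorem two_le_mc (hA : (setA G).Nonempty) : 2 ≤ mc G := by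
  obtain ⟨-, -, u, ⟨N, hN, hu⟩, -⟩ := hA
  by_contra! h
  have h1 : mc G ≤ (1 : ℕ) := by
    rw [show (2 : ℕ∞) = 1 + 1 by norm_num] at h
    exact_mod_cast Order.le_of_lt_add_one h
  obtain ⟨M, hM, hcov⟩ := mc_le_iff.1 h1
  have huniv : (M 0).verts = Set.univ := by
    refine Set.eq_univ_of_forall fun x => ?_
    obtain ⟨i, hi⟩ := Set.mem_iUnion.1 (hcov (Set.mem_univ x))
    rwa [Subsingleton.elim i 0] at hi
  have hle := hN.ncard_verts_le (hM 0).1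
  rw [huniv] at hle
  exact hu (Set.eq_of_subset_of_ncard_le (Set.subset_univ _) hle (Set.toFinite _) ▸ Set.mem_univ u)

/-- Every vertex of `G` lies on an edge, so one single-edge matching per vertex covers `G`; this
cover restricts to `G*`. -/
theorem mdStar_ne_top (hG : G.Connected) (hA : (setA G).Nonempty) : mdStar G ≠ ⊤ := by
  obtain ⟨v, -, u, -, huv⟩ := hA
  have : Nontrivial V := ⟨u, v, huv.ne⟩
  choose f hf using fun x => hG.preconnected.exists_adj_of_nontrivial x
  have : HasMatchingCover (⊤ : G.Subgraph) Set.univ (Nat.card V) := by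
    refine ⟨fun i => G.subgraphOfAdj (hf ((Finite.equivFin V).symm i)),
      fun i => ⟨.subgraphOfAdj _, le_top⟩, fun x _ => ?_⟩
    exact Set.mem_iUnion.2 ⟨Finite.equivFin V x, by simp⟩
  exact ne_top_of_le_ne_top (ENat.natCast_ne_top _) (mdStar_le_iff.2 this.restrict_graphStar)

end MatchingCover

theorem mainTheorem2 {V : Type*} [Finite V] (G : SimpleGraph V) (hG : G.Connected)
    (hA : (MatchingCover.setA G).Nonempty) :
    MatchingCover.mdStar G ≠ ⊤ ∧
    (MatchingCover.mdStar G ≤ 1 → MatchingCover.mc G = 2) ∧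
    (2 ≤ MatchingCover.mdStar G → MatchingCover.mc G = MatchingCover.mdStar G) := by
  have htop := MatchingCover.mdStar_ne_top hG hA
  refine ⟨htop, fun h => ?_, fun h => ?_⟩
  · refine le_antisymm ?_ (MatchingCover.two_le_mc hA)
    exact_mod_cast MatchingCover.mc_le_of_mdStar_le (n := 2) (h.trans (by norm_num)) le_rfl
  · refine le_antisymm ?_ (MatchingCover.mdStar_le_mc G)
    obtain ⟨n, hn⟩ := ENat.ne_top_iff_exists.1 htop
    rw [← hn] at h ⊢
    exact MatchingCover.mc_le_of_mdStar_le hn.ge (by exact_mod_cast h)
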